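/- Let $n\ge 0$, let $f\colon\{0,1\}^n\to\{0,1\}$ and let ${\sf col}\colon E(\{0,1\}^n)\to\{{\sf red},{\sf blue}\}$ be a $2$-coloring of the edges of the hypercube (the unordered pairs $\{x,x\oplus e_i\}$). An edge $\{x,x\oplus e_i\}$ is sensitive if $f(x)\ne f(x\oplus e_i)$. Let $s_{f,{\sf red}}(x)$ be $0$ if $f(x)=0$, and otherwise the number of red sensitive edges at $x$; let $s_{f,{\sf blue}}(x)$ be $0$ if $f(x)=1$, and otherwise the number of blue sensitive edges at $x$. With $x$ uniform in $\{0,1\}^n$ put $${\sf Talagrand}_{\sf col}(f)=\mathbb{E}_x\sqrt{s_{f,{\sf red}}(x)}+\mathbb{E}_x\sqrt{s_{f,{\sf blue}}(x)},$$ $\widehat f(S)=\mathbb{E}_x\big[f(x)\prod_{i\in S}(-1)^{x_i}\big]$, $W_{=d}[f]=\sum_{|S|=d}\widehat f(S)^2$, $W_{\ge d}[f]=\sum_{|S|\ge d}\widehat f(S)^2$, $I_i[f]=\Pr_x[f(x)\ne f(x\oplus e_i)]$, and let ${\sf var}(f)$ be the variance of $f(x)$. Then, for all $n$, $f$ and ${\sf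 col}$: 1. ${\sf Talagrand}_{\sf col}(f)\ge \frac12\sqrt{W_{=1}[f]}$. Moreover there is an absolute constant $c>0$ such that, for all $n$, $f$ and ${\sf col}$: 2. ${\sf Talagrand}_{\sf col}(f)\ge c\,\sqrt d\;W_{\ge d}[f]$ for every $d\in\mathbb{N}$; 3. ${\sf Talagrand}_{\sf col}(f)\ge c\;{\sf var}(f)\sqrt{\log(1/{\sf var}(f))}$; 4. ${\sf Talagrand}_{\sf col}(f)\ge c\;{\sf var}(f)\sqrt{\log\Big(1+\frac{1}{\sum_{i=1}^n I_i[f]^2}\Big)}$. In 3 and 4 the right-hand side is read as $0$ when ${\sf var}(f)=0$, i.e. when $f$ is constant. -/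

import Mathlib

open scoped BigOperators

/-- The vertex set `{0,1}^n` of the hypercube. -/
abbrev Cube (n : ℕ) : Type := Fin n → Bool

/-- The hypercube graph: two points are adjacent iff they differ in exactly one coordinate. -/
def cubeGraph (n : ℕ) : SimpleGraph (Cube n) where
  Adj x y := hammingDist x y = 1
  symm := ⟨fun x y h => by rw [hammingDist_comm]; exact h⟩
  loopless := ⟨fun x h => by simp at h⟩

/-- `x ⊕ e_i`. -/
def flipAt {n : ℕ} (x : Cube n) (i : Fin n) : Cube n := Function.update x i (!x i)

theorem cubeGraph_adj_flipAt {n : ℕ} (x : Cube n) (i : Fin n) :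
    (cubeGraph n).Adj x (flipAt x i) := by
  have h : (Finset.univ.filter fun j => x j ≠ flipAt x i j) = {i} := by
    ext j
    rw [Finset.mem_filter, Finset.mem_singleton]
    by_cases hj : j = i
    · subst hj; simp [flipAt]
    · simp [flipAt, hj]
  change (Finset.univ.filter fun j => x j ≠ flipAt x i j).card = 1
  rw [h, Finset.card_singleton]

/-- The (undirected) edge `{x, x ⊕ e_i}` of the hypercube. -/
def edgeAt {n : ℕ} (x : Cube n) (i : Fin n) : (cubeGraph n).edgeSet :=
  ⟨s(x, flipAt x i), (SimpleGraph.mem_edgeSet _).2 (cubeGraph_adj_flipAt x i)⟩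

/-- The two colors. -/
inductive EdgeColor : Type
  | red : EdgeColor
  | blue : EdgeColor

/-- A 2-coloring of the edges of the hypercube. -/
abbrev EdgeColoring (n : ℕ) : Type := (cubeGraph n).edgeSet → EdgeColor

noncomputable section

/-- A Boolean function, regarded as a real-valued function with values `0` and `1`. -/
def boolToReal {n : ℕ} (f : Cube n → Bool) (x : Cube n) : ℝ := if f x = true then 1 else 0

/-- The character `χ_S(x) = ∏_{i ∈ S} (-1)^{x_i}`. -/
def chi {n : ℕ} (S : Finset (Fin n)) (x : Cube n) : ℝ :=
  ∏ i ∈ S, (if x i = true then (-1 : ℝ) else 1)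

/-- The Fourier coefficient `E_x [f(x) χ_S(x)]`, for `x` uniform in `{0,1}^n`. -/
def cubeFourier {n : ℕ} (f : Cube n → ℝ) (S : Finset (Fin n)) : ℝ :=
  𝔼 x : Cube n, f x * chi S x

/-- The level `d` Fourier weight `W_{=d}[f]`. -/
def weightEq {n : ℕ} (d : ℕ) (f : Cube n → ℝ) : ℝ :=
  ∑ S : Finset (Fin n) with S.card = d, cubeFourier f S ^ 2

/-- The Fourier weight `W_{≥d}[f]` at levels at least `d`. -/
def weightGe {n : ℕ} (d : ℕ) (f : Cube n → ℝ) : ℝ :=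
  ∑ S : Finset (Fin n) with d ≤ S.card, cubeFourier f S ^ 2

/-- The variance of `f(x)` for `x` uniform in `{0,1}^n`. -/
def cubeVar {n : ℕ} (f : Cube n → ℝ) : ℝ :=
  𝔼 x : Cube n, (f x - 𝔼 y : Cube n, f y) ^ 2

/-- The influence `I_i[f] = Pr_x [f(x) ≠ f(x ⊕ e_i)]`. -/
def influence {n : ℕ} (f : Cube n → Bool) (i : Fin n) : ℝ :=
  𝔼 x : Cube n, (if f x ≠ f (flipAt x i) then (1 : ℝ) else 0)

open Classical in
/-- The red sensitivity: `0` if `f(x) = 0`, otherwise the number of red sensitive edges at `x`. -/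
def redSens {n : ℕ} (col : EdgeColoring n) (f : Cube n → Bool) (x : Cube n) : ℕ :=
  if f x = false then 0 else
    (Finset.univ.filter fun i : Fin n =>
      f (flipAt x i) ≠ f x ∧ col (edgeAt x i) = EdgeColor.red).card

open Classical in
/-- The blue sensitivity: `0` if `f(x) = 1`, otherwise the number of blue sensitive edges at `x`. -/
def blueSens {n : ℕ} (col : EdgeColoring n) (f : Cube n → Bool) (x : Cube n) : ℕ :=
  if f x = true then 0 else
    (Finset.univ.filter fun i : Fin n =>
      f (flipAt x i) ≠ f x ∧ col (edgeAt x i) = EdgeColor.blue).card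

/-- `Talagrand_col(f) = E_x √(s_{f,red}(x)) + E_x √(s_{f,blue}(x))`. -/
def talagrandCol {n : ℕ} (col : EdgeColoring n) (f : Cube n → Bool) : ℝ :=
  (𝔼 x : Cube n, Real.sqrt (redSens col f x : ℝ)) +
    𝔼 x : Cube n, Real.sqrt (blueSens col f x : ℝ)

end

/-! Charge each sensitive edge to its endpoint of value 1 if it is red and to its endpoint of value
0 if it is blue. Then `talagrandCol` is the mean of the square root of the number of edges charged
to `x` (`talagrandCol_eq_expect_sqrt`). The coefficient at `{i}` is a sum over edges in direction
`i`, and an edge's contribution can be booked entirely at the charged endpoint. So the level-one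
coefficients form the mean of vectors with entries `0, ±1` supported on the charged directions, and
the triangle inequality for the Euclidean norm gives item 1, for every coloring.

Item 2 applies this to random restrictions in which each coordinate stays free with probability `p`.
The expected level-one weight is `∑ |S| p (1-p)^(|S|-1) f̂(S)²`, while by Jensen the charged side
shrinks by `√p` (`sum_weight_le_sqrt_mul_talagrandCol`). Taking `p ≈ 1/d` controls the levels in
`[d, 2d)`, and the dyadic blocks sum geometrically.

For items 3 and 4, hypercontractivity bounds the weight at levels `1, …, d` by `2·3^d var^(3/2)` and
by `12^d √(∑ I_i²)`. Hence at least half of the variance lies above a level of logarithmic order,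
where item 2 applies (`cubeVar_mul_sqrt_le_of_weightMid_le`). -/

/-! ### Fourier analysis on the cube -/

theorem flipAt_same {n : ℕ} (x : Cube n) (i : Fin n) : flipAt x i i = !x i := by
  simp [flipAt]

theorem flipAt_of_ne {n : ℕ} (x : Cube n) {i j : Fin n} (h : j ≠ i) : flipAt x i j = x j := by
  simp [flipAt, h]

theorem flipAt_flipAt {n : ℕ} (x : Cube n) (i : Fin n) : flipAt (flipAt x i) i = x := by
  funext j
  by_cases h : j = i
  · subst h; simp [flipAt_same]
  · simp [flipAt_of_ne _ h]

theorem expect_flipAt {n : ℕ} (g : Cube n → ℝ) (i : Fin n) :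
    𝔼 x : Cube n, g (flipAt x i) = 𝔼 x : Cube n, g x :=
  Fintype.expect_equiv
    (Function.Involutive.toPerm (fun x : Cube n => flipAt x i) fun x => flipAt_flipAt x i)
    _ _ fun _ => rfl

theorem expect_eq_zero_of_flipAt {n : ℕ} (g : Cube n → ℝ) (i : Fin n)
    (h : ∀ x, g (flipAt x i) = -g x) : 𝔼 x : Cube n, g x = 0 := by
  have h1 := expect_flipAt g i
  simp_rw [h, Finset.expect_neg_distrib] at h1
  linarith

theorem chi_empty {n : ℕ} (x : Cube n) : chi ∅ x = 1 := by simp [chi]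

theorem chi_flipAt_of_notMem {n : ℕ} {S : Finset (Fin n)} {i : Fin n} (h : i ∉ S) (x : Cube n) :
    chi S (flipAt x i) = chi S x := by
  refine Finset.prod_congr rfl fun j hj => ?_
  rw [flipAt_of_ne x (ne_of_mem_of_not_mem hj h)]

theorem chi_flipAt_of_mem {n : ℕ} {S : Finset (Fin n)} {i : Fin n} (h : i ∈ S) (x : Cube n) :
    chi S (flipAt x i) = -chi S x := by
  unfold chi
  rw [← Finset.mul_prod_erase S _ h, ← Finset.mul_prod_erase S (fun j => if x j = true then _ else _) h,
    flipAt_same]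
  have : ∏ j ∈ S.erase i, (if flipAt x i j = true then (-1 : ℝ) else 1) =
      ∏ j ∈ S.erase i, (if x j = true then (-1 : ℝ) else 1) := by
    refine Finset.prod_congr rfl fun j hj => ?_
    rw [flipAt_of_ne x (Finset.ne_of_mem_erase hj)]
  rw [this]
  cases x i <;> simp

theorem chi_mul_self {n : ℕ} (S : Finset (Fin n)) (x : Cube n) : chi S x * chi S x = 1 := by
  unfold chi
  rw [← Finset.prod_mul_distrib]
  exact Finset.prod_eq_one fun i _ => by split_ifs <;> norm_num

theorem abs_chi {n : ℕ} (S : Finset (Fin n)) (x : Cube n) : |chi S x| = 1 := by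
  have := chi_mul_self S x
  rw [← abs_mul_abs_self] at this
  nlinarith [abs_nonneg (chi S x)]

theorem chi_insert {n : ℕ} {S : Finset (Fin n)} {i : Fin n} (h : i ∉ S) (x : Cube n) :
    chi (insert i S) x = chi {i} x * chi S x := by
  simp [chi, Finset.prod_insert h]

theorem expect_chi_mul_chi {n : ℕ} (S T : Finset (Fin n)) :
    𝔼 x : Cube n, chi S x * chi T x = if S = T then 1 else 0 := by
  split_ifs with h
  · subst h
    simp_rw [chi_mul_self]
    exact Fintype.expect_const _
  · obtain ⟨i, hi⟩ : ∃ i, ¬(i ∈ S ↔ i ∈ T) := by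
      by_contra! hc
      exact h (Finset.ext hc)
    refine expect_eq_zero_of_flipAt _ i fun x => ?_
    by_cases hS : i ∈ S
    · have hT : i ∉ T := fun hT => hi ⟨fun _ => hT, fun _ => hS⟩
      rw [chi_flipAt_of_mem hS, chi_flipAt_of_notMem hT]; ring
    · have hT : i ∈ T := by tauto
      rw [chi_flipAt_of_notMem hS, chi_flipAt_of_mem hT]; ring

theorem expect_sum_mul_sum_chi {n : ℕ} (a b : Finset (Fin n) → ℝ) :
    𝔼 x : Cube n, (∑ S, a S * chi S x) * (∑ S, b S * chi S x) = ∑ S, a S * b S := by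
  simp_rw [Finset.sum_mul_sum, Finset.expect_sum_comm]
  refine Finset.sum_congr rfl fun S _ => ?_
  have : ∀ T, 𝔼 x : Cube n, a S * chi S x * (b T * chi T x) =
      a S * b T * if S = T then 1 else 0 := fun T => by
    rw [← expect_chi_mul_chi, Finset.mul_expect]
    exact Finset.expect_congr rfl fun x _ => by ring
  simp [this]

theorem expect_sum_chi_sq {n : ℕ} (a : Finset (Fin n) → ℝ) :
    𝔼 x : Cube n, (∑ S, a S * chi S x) ^ 2 = ∑ S, a S ^ 2 := by
  simp_rw [pow_two]
  exact expect_sum_mul_sum_chi a a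

theorem cubeFourier_sum_chi {n : ℕ} (a : Finset (Fin n) → ℝ) (T : Finset (Fin n)) :
    cubeFourier (fun x => ∑ S, a S * chi S x) T = a T := by
  have := expect_sum_mul_sum_chi a (fun S => if S = T then 1 else 0)
  simpa [cubeFourier] using this

/-- Serves twice: `ρ = 1` gives completeness of the characters, and general `ρ` diagonalizes the
noise kernel. -/
theorem sum_pow_mul_chi_mul_chi {n : ℕ} (ρ : ℝ) (x y : Cube n) :
    ∑ S : Finset (Fin n), ρ ^ S.card * (chi S x * chi S y) =
      ∏ i, (1 + ρ * (chi {i} x * chi {i} y)) := by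
  rw [Finset.prod_one_add, Finset.powerset_univ]
  refine Finset.sum_congr rfl fun S _ => ?_
  rw [Finset.prod_mul_distrib, Finset.prod_mul_distrib, Finset.prod_const]
  simp [chi]

theorem sum_chi_mul_chi {n : ℕ} (x y : Cube n) :
    ∑ S : Finset (Fin n), chi S x * chi S y = if x = y then 2 ^ n else 0 := by
  have h := sum_pow_mul_chi_mul_chi 1 x y
  simp only [one_pow, one_mul] at h
  rw [h]
  split_ifs with hxy
  · subst hxy
    simp [chi_mul_self]
    norm_num
  · obtain ⟨i, hi⟩ := Function.ne_iff.1 hxy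
    refine Finset.prod_eq_zero (Finset.mem_univ i) ?_
    simp only [chi, Finset.prod_singleton]
    cases hx : x i <;> cases hy : y i <;> simp_all

theorem cubeFourier_inversion {n : ℕ} (f : Cube n → ℝ) (x : Cube n) :
    ∑ S, cubeFourier f S * chi S x = f x := by
  unfold cubeFourier
  simp_rw [Finset.expect_mul]
  rw [← Finset.expect_sum_comm]
  have : ∀ y : Cube n, ∑ S, f y * chi S y * chi S x = f y * if y = x then 2 ^ n else 0 := fun y => by
    rw [← sum_chi_mul_chi, Finset.mul_sum]
    exact Finset.sum_congr rfl fun S _ => by ring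
  simp_rw [this]
  rw [Fintype.expect_eq_sum_div_card]
  simp

theorem parseval {n : ℕ} (f : Cube n → ℝ) :
    ∑ S, cubeFourier f S ^ 2 = 𝔼 x : Cube n, f x ^ 2 := by
  rw [← expect_sum_chi_sq]
  simp_rw [cubeFourier_inversion]

theorem boolToReal_nonneg {n : ℕ} (f : Cube n → Bool) (x : Cube n) : 0 ≤ boolToReal f x := by
  unfold boolToReal; split_ifs <;> norm_num

theorem boolToReal_le_one {n : ℕ} (f : Cube n → Bool) (x : Cube n) : boolToReal f x ≤ 1 := by
  unfold boolToReal; split_ifs <;> norm_num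

theorem boolToReal_sq {n : ℕ} (f : Cube n → Bool) (x : Cube n) :
    boolToReal f x ^ 2 = boolToReal f x := by
  unfold boolToReal; split_ifs <;> norm_num

theorem sum_cubeFourier_sq_le_one {n : ℕ} (f : Cube n → Bool) :
    ∑ S, cubeFourier (boolToReal f) S ^ 2 ≤ 1 := by
  rw [parseval]
  refine Finset.expect_le Finset.univ_nonempty fun x _ => ?_
  rw [boolToReal_sq]
  exact boolToReal_le_one f x

/-! ### Charging each sensitive edge to one endpoint -/

open Classical in
/-- The sensitive directions at `x` whose edge is charged to `x`: an edge is charged to its endpoint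
with value `1` if it satisfies `r`, and to its endpoint with value `0` otherwise. -/
noncomputable def chargedEdges {n : ℕ} (r : Cube n → Fin n → Prop) (f : Cube n → Bool)
    (x : Cube n) : Finset (Fin n) :=
  Finset.univ.filter fun i => f (flipAt x i) ≠ f x ∧ (f x = true ↔ r x i)

theorem talagrandCol_eq_expect_sqrt {n : ℕ} (col : EdgeColoring n) (f : Cube n → Bool) :
    talagrandCol col f = 𝔼 x : Cube n,
      √((chargedEdges (fun x i => col (edgeAt x i) = EdgeColor.red) f x).card : ℝ) := by
  -- At each `x` one of the two sensitivities vanishes, so the sum of the two roots is the root of a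
  -- single count.
  unfold talagrandCol
  rw [← Finset.expect_add_distrib]
  refine Finset.expect_congr rfl fun x _ => ?_
  unfold redSens blueSens chargedEdges
  cases hf : f x
  · simp only [if_true, Bool.false_eq_true, if_false, Nat.cast_zero, Real.sqrt_zero, zero_add,
      false_iff]
    congr 3
    ext i
    simp only [Finset.mem_filter]
    cases col (edgeAt x i) <;> simp
  · simp only [Bool.true_eq_false, if_true, if_false, Nat.cast_zero, Real.sqrt_zero, add_zero]
    congr 3
    ext i
    simp

theorem talagrandCol_nonneg {n : ℕ} (col : EdgeColoring n) (f : Cube n → Bool) :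
    0 ≤ talagrandCol col f := by
  rw [talagrandCol_eq_expect_sqrt]
  exact Finset.expect_nonneg fun x _ => Real.sqrt_nonneg _

theorem edgeAt_flipAt {n : ℕ} (x : Cube n) (i : Fin n) : edgeAt (flipAt x i) i = edgeAt x i := by
  apply Subtype.ext
  simp only [edgeAt, flipAt_flipAt]
  exact Sym2.eq_swap

/-- The Euclidean norm is convex: pair the mean vector with each `u x` and apply Cauchy–Schwarz. -/
theorem sqrt_sum_expect_sq_le {ι κ : Type*} [Fintype ι] [Fintype κ] (u : κ → ι → ℝ) :
    √(∑ i, (𝔼 x, u x i) ^ 2) ≤ 𝔼 x, √(∑ i, u x i ^ 2) := by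
  set a : ι → ℝ := fun i => 𝔼 x, u x i with ha
  have hA : 0 ≤ ∑ i, a i ^ 2 := Finset.sum_nonneg fun i _ => sq_nonneg _
  have hB : 0 ≤ 𝔼 x, √(∑ i, u x i ^ 2) := Finset.expect_nonneg fun x _ => Real.sqrt_nonneg _
  have key : ∑ i, a i ^ 2 ≤ √(∑ i, a i ^ 2) * 𝔼 x, √(∑ i, u x i ^ 2) := by
    calc ∑ i, a i ^ 2 = 𝔼 x, ∑ i, a i * u x i := by
          rw [Finset.expect_sum_comm]
          refine Finset.sum_congr rfl fun i _ => ?_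
          rw [← Finset.mul_expect, pow_two]
      _ ≤ 𝔼 x, √(∑ i, a i ^ 2) * √(∑ i, u x i ^ 2) :=
          Finset.expect_le_expect fun x _ => Real.sum_mul_le_sqrt_mul_sqrt _ _ _
      _ = _ := by rw [Finset.mul_expect]
  rcases hA.eq_or_lt with h | h
  · rw [← h, Real.sqrt_zero]; exact hB
  · have hs := Real.sqrt_pos.2 h
    nlinarith [Real.mul_self_sqrt hA]

/-- The charging rule `r` is an arbitrary edge-symmetric predicate, so that the bound also applies
to restrictions of `f`, which inherit a rule rather than a coloring. -/
theorem sqrt_level_one_le_expect_sqrt {n : ℕ} (r : Cube n → Fin n → Prop)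
    (hr : ∀ x i, r (flipAt x i) i ↔ r x i) (f : Cube n → Bool) :
    √(∑ i, cubeFourier (boolToReal f) {i} ^ 2) ≤
      𝔼 x : Cube n, √((chargedEdges r f x).card : ℝ) := by
  classical
  set u : Cube n → Fin n → ℝ := fun x i =>
    if i ∈ chargedEdges r f x then (if f x = true then 1 else -1) * chi {i} x else 0 with hu
  have h1 : ∀ i, cubeFourier (boolToReal f) {i} = 𝔼 x, u x i := fun i => by
    -- Over an edge in direction `i`, both terms have the same total `χ_i(x) (f(x) - f(x ⊕ e_i))`,
    -- so the difference is odd under the flip.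
    have : 𝔼 x : Cube n, (boolToReal f x * chi {i} x - u x i) = 0 := by
      refine expect_eq_zero_of_flipAt _ i fun x => ?_
      have hc : chi {i} (flipAt x i) = -chi {i} x := chi_flipAt_of_mem (by simp) x
      simp only [hu, chargedEdges, Finset.mem_filter, Finset.mem_univ, true_and, hr, hc,
        flipAt_flipAt, boolToReal]
      by_cases hri : r x i <;> cases f x <;> cases f (flipAt x i) <;> simp [hri]
    rw [Finset.expect_sub_distrib] at this
    unfold cubeFourier
    linarith
  simp_rw [h1]
  refine (sqrt_sum_expect_sq_le u).trans_eq (Finset.expect_congr rfl fun x _ => ?_)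
  congr 1
  have : ∀ i, u x i ^ 2 = if i ∈ chargedEdges r f x then 1 else 0 := fun i => by
    have := chi_mul_self {i} x
    simp only [hu]
    split_ifs <;> nlinarith
  simp [this]

theorem weightEq_one {n : ℕ} (f : Cube n → ℝ) :
    weightEq 1 f = ∑ i, cubeFourier f {i} ^ 2 := by
  unfold weightEq
  symm
  refine Finset.sum_bij (fun i _ => {i}) ?_ ?_ ?_ ?_
  · intro i _; simp
  · intro i _ j _ h; simpa using h
  · intro S hS
    obtain ⟨i, hi⟩ := Finset.card_eq_one.1 (Finset.mem_filter.1 hS).2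
    exact ⟨i, Finset.mem_univ _, hi.symm⟩
  · intro i _; rfl

theorem sqrt_weightEq_one_le_talagrandCol {n : ℕ} (f : Cube n → Bool) (col : EdgeColoring n) :
    √(weightEq 1 (boolToReal f)) ≤ talagrandCol col f := by
  rw [talagrandCol_eq_expect_sqrt, weightEq_one]
  exact sqrt_level_one_le_expect_sqrt _ (fun x i => by rw [edgeAt_flipAt]) f

/-! ### Random restrictions -/

/-- The point agreeing with `y` on `J` and with `x` off `J`. -/
def mixAt {n : ℕ} (J : Finset (Fin n)) (y x : Cube n) : Cube n :=
  fun i => if i ∈ J then y i else x i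

/-- Exchanging the `J`-coordinates of two independent uniform points preserves their joint law. -/
theorem expect_expect_mixAt {n : ℕ} (J : Finset (Fin n)) (g : Cube n → ℝ) :
    𝔼 x : Cube n, 𝔼 y : Cube n, g (mixAt J y x) = 𝔼 x : Cube n, g x := by
  have hinv : Function.Involutive
      (fun p : Cube n × Cube n => (mixAt J p.2 p.1, mixAt J p.1 p.2)) := by
    rintro ⟨x, y⟩
    ext i <;> by_cases h : i ∈ J <;> simp [mixAt, h]
  calc 𝔼 x : Cube n, 𝔼 y : Cube n, g (mixAt J y x)
      = 𝔼 p : Cube n × Cube n, g (mixAt J p.2 p.1) := by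
        rw [← Finset.univ_product_univ, Finset.expect_product]
    _ = 𝔼 p : Cube n × Cube n, g p.1 :=
        Fintype.expect_equiv hinv.toPerm _ _ fun _ => rfl
    _ = 𝔼 x : Cube n, 𝔼 _y : Cube n, g x := by
        rw [← Finset.univ_product_univ, Finset.expect_product]
    _ = _ := by simp_rw [Fintype.expect_const]

theorem chi_mixAt {n : ℕ} (S J : Finset (Fin n)) (y x : Cube n) :
    chi S (mixAt J y x) = chi (S ∩ J) y * chi (S \ J) x := by
  unfold chi
  rw [← Finset.prod_inter_mul_prod_sdiff S J]
  congr 1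
  · exact Finset.prod_congr rfl fun i hi => by simp [mixAt, (Finset.mem_inter.1 hi).2]
  · exact Finset.prod_congr rfl fun i hi => by simp [mixAt, (Finset.mem_sdiff.1 hi).2]

theorem flipAt_mixAt {n : ℕ} {J : Finset (Fin n)} {j : Fin n} (hj : j ∈ J) (y x : Cube n) :
    mixAt J (flipAt y j) x = flipAt (mixAt J y x) j := by
  funext i
  by_cases h : i = j
  · subst h; simp [mixAt, hj, flipAt_same]
  · simp [mixAt, flipAt_of_ne _ h]

theorem flipAt_mixAt_of_notMem {n : ℕ} {J : Finset (Fin n)} {j : Fin n} (hj : j ∉ J)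
    (y x : Cube n) : mixAt J (flipAt y j) x = mixAt J y x := by
  funext i
  by_cases h : i = j
  · subst h; simp [mixAt, hj]
  · simp [mixAt, flipAt_of_ne _ h]

theorem cubeFourier_mixAt {n : ℕ} (f : Cube n → ℝ) (J : Finset (Fin n)) (T : Finset (Fin n))
    (x : Cube n) :
    cubeFourier (fun y => f (mixAt J y x)) T =
      ∑ S, (if S ∩ J = T then cubeFourier f S else 0) * chi (S \ J) x := by
  unfold cubeFourier
  calc 𝔼 y : Cube n, f (mixAt J y x) * chi T y
      = 𝔼 y : Cube n, ∑ S, cubeFourier f S * chi (S \ J) x * (chi (S ∩ J) y * chi T y) := by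
        refine Finset.expect_congr rfl fun y _ => ?_
        rw [← cubeFourier_inversion f, Finset.sum_mul]
        refine Finset.sum_congr rfl fun S _ => ?_
        rw [chi_mixAt]; ring
    _ = _ := by
        rw [Finset.expect_sum_comm]
        refine Finset.sum_congr rfl fun S _ => ?_
        rw [← Finset.mul_expect, expect_chi_mul_chi]
        split_ifs <;> simp [cubeFourier]

/-- Cross terms vanish: distinct sets with the same trace on `J` differ off `J`, so their characters
in `x` are orthogonal. -/
theorem expect_cubeFourier_mixAt_sq {n : ℕ} (f : Cube n → ℝ) (J T : Finset (Fin n)) :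
    𝔼 x : Cube n, cubeFourier (fun y => f (mixAt J y x)) T ^ 2 =
      ∑ S, if S ∩ J = T then cubeFourier f S ^ 2 else 0 := by
  simp_rw [cubeFourier_mixAt, pow_two, Finset.sum_mul_sum, Finset.expect_sum_comm]
  refine Finset.sum_congr rfl fun S _ => ?_
  have : ∀ S', 𝔼 x : Cube n, (if S ∩ J = T then cubeFourier f S else 0) * chi (S \ J) x *
      ((if S' ∩ J = T then cubeFourier f S' else 0) * chi (S' \ J) x) =
      if S = S' then (if S ∩ J = T then cubeFourier f S * cubeFourier f S else 0) else 0 := by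
    intro S'
    have h1 : 𝔼 x : Cube n, (if S ∩ J = T then cubeFourier f S else 0) * chi (S \ J) x *
      ((if S' ∩ J = T then cubeFourier f S' else 0) * chi (S' \ J) x) =
      (if S ∩ J = T then cubeFourier f S else 0) * (if S' ∩ J = T then cubeFourier f S' else 0) *
        if S \ J = S' \ J then 1 else 0 := by
      rw [← expect_chi_mul_chi, Finset.mul_expect]
      exact Finset.expect_congr rfl fun x _ => by ring
    rw [h1]
    by_cases hS : S = S'
    · subst hS; by_cases h2 : S ∩ J = T <;> simp [h2]
    · by_cases h2 : S ∩ J = T <;> by_cases h3 : S' ∩ J = T <;> simp only [h2, h3, hS, if_true,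
        if_false, mul_zero, zero_mul]
      rw [if_neg, mul_zero]
      intro h4
      apply hS
      rw [← Finset.sdiff_union_inter S J, ← Finset.sdiff_union_inter S' J, h4, h2, h3]
  rw [Finset.sum_congr rfl fun S' _ => this S']
  simp

theorem level_one_restriction_le {n : ℕ} (r : Cube n → Fin n → Prop)
    (hr : ∀ x i, r (flipAt x i) i ↔ r x i) (f : Cube n → Bool) (J : Finset (Fin n)) :
    ∑ j, ∑ S, (if S ∩ J = {j} then cubeFourier (boolToReal f) S ^ 2 else 0) ≤
      𝔼 x : Cube n, √((chargedEdges r f x ∩ J).card : ℝ) := by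
  classical
  rw [← expect_expect_mixAt J]
  simp_rw [← expect_cubeFourier_mixAt_sq]
  rw [← Finset.expect_sum_comm]
  refine Finset.expect_le_expect fun x _ => ?_
  set F : Cube n → Bool := fun y => f (mixAt J y x) with hF
  set W := ∑ j, cubeFourier (fun y => boolToReal f (mixAt J y x)) {j} ^ 2 with hW
  have hWF : W = ∑ j, cubeFourier (boolToReal F) {j} ^ 2 := rfl
  have hW0 : 0 ≤ W := Finset.sum_nonneg fun _ _ => sq_nonneg _
  have hW1 : W ≤ 1 := by
    rw [hWF, ← weightEq_one]
    exact (Finset.sum_le_univ_sum_of_nonneg fun S => sq_nonneg _).trans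
      (sum_cubeFourier_sq_le_one F)
  -- Since `W ≤ 1`, the root may be dropped; the left side becomes linear in squared coefficients
  -- and can be averaged exactly.
  have hWs : W ≤ √W := Real.le_sqrt_of_sq_le (by nlinarith)
  refine hWs.trans ?_
  rw [hWF]
  -- Off `J` the restricted function is insensitive, so its charged directions are those of `f`
  -- lying in `J`.
  refine (sqrt_level_one_le_expect_sqrt (fun y j => j ∈ J ∧ r (mixAt J y x) j) ?_ F).trans_eq ?_
  · intro y j
    by_cases hj : j ∈ J
    · simp only [hj, true_and, flipAt_mixAt hj, hr]
    · simp [hj]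
  · refine Finset.expect_congr rfl fun y _ => ?_
    congr 3
    ext j
    by_cases hj : j ∈ J
    · simp [chargedEdges, hF, hj, flipAt_mixAt hj]
    · simp [chargedEdges, hF, hj, flipAt_mixAt_of_notMem hj]

/-- The probability of `J` when every coordinate is chosen independently with probability `p`. -/
def subsetWeight {n : ℕ} (p : ℝ) (J : Finset (Fin n)) : ℝ := p ^ J.card * (1 - p) ^ Jᶜ.card

theorem subsetWeight_nonneg {n : ℕ} {p : ℝ} (h0 : 0 ≤ p) (h1 : p ≤ 1) (J : Finset (Fin n)) :
    0 ≤ subsetWeight p J :=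
  mul_nonneg (pow_nonneg h0 _) (pow_nonneg (by linarith) _)

theorem sum_subsetWeight_mul_prod {n : ℕ} (p : ℝ) (a b : Fin n → ℝ) :
    ∑ J : Finset (Fin n), subsetWeight p J * ((∏ i ∈ J, a i) * ∏ i ∈ Jᶜ, b i) =
      ∏ i, (p * a i + (1 - p) * b i) := by
  rw [Fintype.prod_add]
  refine Finset.sum_congr rfl fun J _ => ?_
  rw [Finset.prod_mul_distrib, Finset.prod_mul_distrib, Finset.prod_const, Finset.prod_const,
    subsetWeight]
  ring

theorem sum_subsetWeight {n : ℕ} (p : ℝ) : ∑ J : Finset (Fin n), subsetWeight p J = 1 := by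
  simpa using sum_subsetWeight_mul_prod (n := n) p 1 1

theorem sum_subsetWeight_mem {n : ℕ} (p : ℝ) (j : Fin n) :
    ∑ J : Finset (Fin n), subsetWeight p J * (if j ∈ J then 1 else 0) = p := by
  have h := sum_subsetWeight_mul_prod p (fun _ : Fin n => 1) (fun i => if i ≠ j then 1 else 0)
  rw [Finset.prod_eq_single j (fun i _ hi => by simp [hi]) (by simp)] at h
  simp only [ne_eq, not_true_eq_false, if_false, mul_zero, add_zero, mul_one] at h
  refine Eq.trans (Finset.sum_congr rfl fun J _ => ?_) h
  rw [Finset.prod_const_one, one_mul, Finset.prod_ite_zero, Finset.prod_const_one]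
  have hiff : (∀ i ∈ Jᶜ, ¬i = j) ↔ j ∈ J := by
    constructor
    · intro h
      by_contra hj
      exact h j (Finset.mem_compl.2 hj) rfl
    · rintro hj i hi rfl
      exact Finset.mem_compl.1 hi hj
  simp only [hiff]

/-- The event is a conjunction of independent conditions: `j` is chosen and the other elements of
`S` are not. -/
theorem sum_subsetWeight_inter_eq_singleton {n : ℕ} (p : ℝ) {S : Finset (Fin n)} {j : Fin n}
    (hj : j ∈ S) :
    ∑ J : Finset (Fin n), subsetWeight p J * (if S ∩ J = {j} then 1 else 0) =
      p * (1 - p) ^ (S.card - 1) := by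
  have h := sum_subsetWeight_mul_prod p (fun i : Fin n => if i ∉ S.erase j then 1 else 0)
    (fun i => if i ≠ j then 1 else 0)
  have hprod : ∏ i, (p * (if i ∉ S.erase j then 1 else 0) + (1 - p) * (if i ≠ j then 1 else 0)) =
      p * (1 - p) ^ (S.card - 1) := by
    rw [← Finset.mul_prod_erase _ _ (Finset.mem_univ j), ← Finset.card_erase_of_mem hj,
      ← Finset.prod_subset (Finset.erase_subset_erase j (Finset.subset_univ S)),
      Finset.prod_congr rfl (g := fun _ => 1 - p), Finset.prod_const]
    · simp
    · intro i hi
      simp [hi, (Finset.mem_erase.1 hi).1]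
    · intro i hi hi'
      simp only [Finset.mem_erase, not_and, Finset.mem_univ, and_true] at hi hi'
      simp [hi, hi' hi]
  rw [← hprod, ← h]
  refine Finset.sum_congr rfl fun J _ => ?_
  rw [Finset.prod_ite_zero, Finset.prod_const_one, Finset.prod_ite_zero, Finset.prod_const_one,
    ite_zero_mul_ite_zero, one_mul]
  have hiff : ((∀ i ∈ J, i ∉ S.erase j) ∧ ∀ i ∈ Jᶜ, i ≠ j) ↔ S ∩ J = {j} := by
    constructor
    · rintro ⟨h1, h2⟩
      have hjJ : j ∈ J := by
        by_contra hc
        exact h2 j (Finset.mem_compl.2 hc) rfl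
      ext i
      rw [Finset.mem_inter, Finset.mem_singleton]
      constructor
      · rintro ⟨hi, hi'⟩
        by_contra hc
        exact h1 i hi' (Finset.mem_erase.2 ⟨hc, hi⟩)
      · rintro rfl
        exact ⟨hj, hjJ⟩
    · intro h
      have hm : ∀ i, (i ∈ S ∧ i ∈ J ↔ i = j) := fun i => by
        rw [← Finset.mem_inter, h, Finset.mem_singleton]
      refine ⟨fun i hi hi' => ?_, fun i hi hij => ?_⟩
      · exact (Finset.mem_erase.1 hi').1 ((hm i).1 ⟨(Finset.mem_erase.1 hi').2, hi⟩)
      · exact Finset.mem_compl.1 hi ((hm i).2 hij).2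
  simp only [hiff]

/-- Jensen for the concave root, the mean of `|A ∩ J|` being `p |A|`. -/
theorem sum_subsetWeight_mul_sqrt_card_le {n : ℕ} {p : ℝ} (h0 : 0 ≤ p) (h1 : p ≤ 1)
    (A : Finset (Fin n)) :
    ∑ J : Finset (Fin n), subsetWeight p J * √((A ∩ J).card : ℝ) ≤ √p * √(A.card : ℝ) := by
  have hcard : ∑ J : Finset (Fin n), subsetWeight p J * ((A ∩ J).card : ℝ) = p * A.card := by
    have : ∀ J : Finset (Fin n), ((A ∩ J).card : ℝ) = ∑ j ∈ A, if j ∈ J then 1 else 0 := fun J => by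
      rw [Finset.sum_boole, Finset.filter_mem_eq_inter]
    simp_rw [this, Finset.mul_sum]
    rw [Finset.sum_comm, Finset.sum_congr rfl fun j _ => sum_subsetWeight_mem p j]
    simp [mul_comm]
  rw [← Real.sqrt_mul h0, ← hcard]
  exact Real.strictConcaveOn_sqrt.concaveOn.le_map_sum
    (fun J _ => subsetWeight_nonneg h0 h1 J) (sum_subsetWeight p) (fun J _ => by simp)

theorem sum_weight_le_sqrt_mul_talagrandCol {n : ℕ} (f : Cube n → Bool) (col : EdgeColoring n)
    {p : ℝ} (h0 : 0 ≤ p) (h1 : p ≤ 1) :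
    ∑ S : Finset (Fin n), S.card * (p * (1 - p) ^ (S.card - 1)) *
      cubeFourier (boolToReal f) S ^ 2 ≤ √p * talagrandCol col f := by
  classical
  set r : Cube n → Fin n → Prop := fun x i => col (edgeAt x i) = EdgeColor.red with hr
  have hsym : ∀ x i, r (flipAt x i) i ↔ r x i := fun x i => by simp only [hr, edgeAt_flipAt]
  have hS : ∀ S : Finset (Fin n), S.card * (p * (1 - p) ^ (S.card - 1)) *
      cubeFourier (boolToReal f) S ^ 2 = ∑ J : Finset (Fin n), subsetWeight p J *
        ∑ j, (if S ∩ J = {j} then cubeFourier (boolToReal f) S ^ 2 else 0) := by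
    intro S
    simp_rw [Finset.mul_sum]
    rw [Finset.sum_comm]
    have : ∀ j, ∑ J : Finset (Fin n), subsetWeight p J *
        (if S ∩ J = {j} then cubeFourier (boolToReal f) S ^ 2 else 0) =
        if j ∈ S then p * (1 - p) ^ (S.card - 1) * cubeFourier (boolToReal f) S ^ 2 else 0 := by
      intro j
      split_ifs with hj
      · rw [← sum_subsetWeight_inter_eq_singleton p hj, Finset.sum_mul]
        refine Finset.sum_congr rfl fun J _ => ?_
        split_ifs <;> ring
      · refine Finset.sum_eq_zero fun J _ => ?_
        rw [if_neg, mul_zero]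
        intro h
        exact hj (Finset.mem_inter.1 (h ▸ Finset.mem_singleton_self j)).1
    simp_rw [this]
    simp [mul_assoc]
  calc _ = ∑ J : Finset (Fin n), subsetWeight p J * ∑ j, ∑ S,
        (if S ∩ J = {j} then cubeFourier (boolToReal f) S ^ 2 else 0) := by
        rw [Finset.sum_congr rfl fun S _ => hS S, Finset.sum_comm]
        refine Finset.sum_congr rfl fun J _ => ?_
        rw [← Finset.mul_sum, Finset.sum_comm]
    _ ≤ ∑ J : Finset (Fin n), subsetWeight p J *
        𝔼 x : Cube n, √((chargedEdges r f x ∩ J).card : ℝ) :=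
        Finset.sum_le_sum fun J _ => mul_le_mul_of_nonneg_left
          (level_one_restriction_le r hsym f J) (subsetWeight_nonneg h0 h1 J)
    _ = 𝔼 x : Cube n, ∑ J : Finset (Fin n), subsetWeight p J *
        √((chargedEdges r f x ∩ J).card : ℝ) := by
        simp_rw [Finset.mul_expect]
        rw [Finset.expect_sum_comm]
    _ ≤ 𝔼 x : Cube n, √p * √((chargedEdges r f x).card : ℝ) :=
        Finset.expect_le_expect fun x _ => sum_subsetWeight_mul_sqrt_card_le h0 h1 _
    _ = _ := by rw [talagrandCol_eq_expect_sqrt, Finset.mul_expect]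

theorem weightGe_sub_weightGe_two_mul_le {n d : ℕ} (hd : 0 < d) (f : Cube n → Bool)
    (col : EdgeColoring n) :
    √d * (weightGe d (boolToReal f) - weightGe (2 * d) (boolToReal f)) ≤
      4 * talagrandCol col f := by
  have hd' : (1 : ℝ) ≤ d := by exact_mod_cast hd
  have hd0 : (0 : ℝ) < d := by linarith
  -- For `d ≤ |S| < 2d`, Bernoulli gives `(1-p)^(|S|-1) ≥ 1 - 2dp = 1/2`, so the coefficient of
  -- `f̂(S)²` is at least `dp/2 = 1/8`.
  set p : ℝ := 1 / (4 * d) with hp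
  have hpd : p * d = 1 / 4 := by rw [hp]; field_simp
  have hp0 : 0 < p := by positivity
  have hp1 : p ≤ 1 := by nlinarith
  have hsq : √p * √d = 1 / 2 := by
    rw [← Real.sqrt_mul hp0.le, hpd, show (1 / 4 : ℝ) = (1 / 2) ^ 2 by norm_num]
    exact Real.sqrt_sq (by norm_num)
  have key : (weightGe d (boolToReal f) - weightGe (2 * d) (boolToReal f)) / 8 ≤
      √p * talagrandCol col f := by
    refine le_trans ?_ (sum_weight_le_sqrt_mul_talagrandCol f col hp0.le hp1)
    unfold weightGe
    rw [Finset.sum_filter, Finset.sum_filter, ← Finset.sum_sub_distrib, Finset.sum_div]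
    refine Finset.sum_le_sum fun S _ => ?_
    have hq : 0 ≤ cubeFourier (boolToReal f) S ^ 2 := sq_nonneg _
    have hnn : 0 ≤ S.card * (p * (1 - p) ^ (S.card - 1)) * cubeFourier (boolToReal f) S ^ 2 := by
      have : 0 ≤ 1 - p := by linarith
      positivity
    by_cases h2 : 2 * d ≤ S.card
    · rw [if_pos h2, if_pos (by omega)]
      simpa using hnn
    · rw [if_neg h2]
      by_cases h3 : d ≤ S.card
      · rw [if_pos h3]
        have hb : (1 / 2 : ℝ) ≤ (1 - p) ^ (S.card - 1) := by
          have hb1 := one_add_mul_le_pow (a := -p) (by linarith) (S.card - 1)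
          have hb2 : ((S.card - 1 : ℕ) : ℝ) ≤ 2 * d := by
            exact_mod_cast (by omega : S.card - 1 ≤ 2 * d)
          rw [← sub_eq_add_neg] at hb1
          nlinarith
        have h3' : (d : ℝ) ≤ S.card := by exact_mod_cast h3
        have : (1 / 8 : ℝ) ≤ S.card * (p * (1 - p) ^ (S.card - 1)) := by
          calc (1 / 8 : ℝ) = d * (p * (1 / 2)) := by linarith
            _ ≤ _ := by gcongr
        nlinarith
      · rw [if_neg h3]
        simpa using hnn
  have hmul := mul_le_mul_of_nonneg_left key (Real.sqrt_nonneg (d : ℝ))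
  have : √d * (√p * talagrandCol col f) = talagrandCol col f / 2 := by
    linear_combination talagrandCol col f * hsq
  linarith

theorem sqrt_mul_weightGe_le {n : ℕ} (f : Cube n → Bool) (col : EdgeColoring n) (d : ℕ) :
    √d * weightGe d (boolToReal f) ≤ 16 * talagrandCol col f := by
  have hT := talagrandCol_nonneg col f
  induction h : n + 1 - d using Nat.strong_induction_on generalizing d with
  | _ k ih =>
    rcases Nat.eq_zero_or_pos d with rfl | hd
    · simpa using hT
    by_cases hdn : n < d
    · have : weightGe d (boolToReal f) = 0 := by
        unfold weightGe
        rw [Finset.sum_eq_zero]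
        intro S hS
        have h1 := (Finset.mem_filter.1 hS).2
        have h2 : S.card ≤ n := by simpa using Finset.card_le_univ S
        omega
      rw [this, mul_zero]
      linarith
    · have h1 := ih (n + 1 - 2 * d) (by omega) (2 * d) rfl
      have h2 := weightGe_sub_weightGe_two_mul_le hd f col
      have h3 : (4 / 3 : ℝ) ≤ √2 := Real.le_sqrt_of_sq_le (by norm_num)
      push_cast at h1
      rw [Real.sqrt_mul (by norm_num), mul_assoc] at h1
      have h4 : 0 ≤ √d * weightGe (2 * d) (boolToReal f) :=
        mul_nonneg (Real.sqrt_nonneg _) (Finset.sum_nonneg fun _ _ => sq_nonneg _)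
      -- The recursion closes because `4 + 16/√2 ≤ 4 + 16 · (3/4) = 16`.
      nlinarith

/-! ### Hypercontractivity -/

theorem expect_mul_sq_le {n : ℕ} (f g : Cube n → ℝ) :
    (𝔼 x, f x * g x) ^ 2 ≤ (𝔼 x, f x ^ 2) * 𝔼 x, g x ^ 2 :=
  Finset.expect_mul_sq_le_sq_mul_sq _ _ _

/-- Bonami's lemma, one coordinate at a time: write the sum as `g + χ_i h`. Odd powers of `χ_i`
average to zero, Cauchy–Schwarz handles `g² h²`, and `A² + 6AB + B² ≤ (A + 3B)²`. -/
theorem expect_pow_four_le_powerset {n : ℕ} (U : Finset (Fin n)) (a : Finset (Fin n) → ℝ) :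
    𝔼 x : Cube n, (∑ S ∈ U.powerset, a S * chi S x) ^ 4 ≤
      (∑ S ∈ U.powerset, 3 ^ S.card * a S ^ 2) ^ 2 := by
  induction U using Finset.induction_on generalizing a with
  | empty => simp [chi_empty]; exact le_of_eq (by ring)
  | insert i U hi ih =>
    have hmem : ∀ S ∈ U.powerset, i ∉ S := fun S hS h => hi (Finset.mem_powerset.1 hS h)
    set g : Cube n → ℝ := fun x => ∑ S ∈ U.powerset, a S * chi S x with hg
    set h : Cube n → ℝ := fun x => ∑ S ∈ U.powerset, a (insert i S) * chi S x with hh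
    have hN : ∑ S ∈ (insert i U).powerset, 3 ^ S.card * a S ^ 2 =
        ∑ S ∈ U.powerset, 3 ^ S.card * a S ^ 2 +
          3 * ∑ S ∈ U.powerset, 3 ^ S.card * a (insert i S) ^ 2 := by
      rw [Finset.sum_powerset_insert hi, Finset.mul_sum]
      congr 1
      refine Finset.sum_congr rfl fun S hS => ?_
      rw [Finset.card_insert_of_notMem (hmem S hS)]
      ring
    have hf : ∀ x, ∑ S ∈ (insert i U).powerset, a S * chi S x = g x + chi {i} x * h x := by
      intro x
      rw [Finset.sum_powerset_insert hi, hh, Finset.mul_sum]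
      congr 1
      refine Finset.sum_congr rfl fun S hS => ?_
      rw [chi_insert (hmem S hS)]
      ring
    have hgi : ∀ x, g (flipAt x i) = g x := fun x => Finset.sum_congr rfl fun S hS => by
      rw [chi_flipAt_of_notMem (hmem S hS)]
    have hhi : ∀ x, h (flipAt x i) = h x := fun x => Finset.sum_congr rfl fun S hS => by
      rw [chi_flipAt_of_notMem (hmem S hS)]
    have hodd : 𝔼 x : Cube n, chi {i} x * (4 * g x ^ 3 * h x + 4 * g x * h x ^ 3) = 0 := by
      refine expect_eq_zero_of_flipAt _ i fun x => ?_
      rw [hgi, hhi, chi_flipAt_of_mem (Finset.mem_singleton_self i)]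
      ring
    have hexp : 𝔼 x : Cube n, (g x + chi {i} x * h x) ^ 4 =
        (𝔼 x : Cube n, g x ^ 4) + 6 * (𝔼 x : Cube n, g x ^ 2 * h x ^ 2) +
          𝔼 x : Cube n, h x ^ 4 := by
      rw [Finset.mul_expect, ← Finset.expect_add_distrib, ← Finset.expect_add_distrib,
        ← sub_eq_zero, ← Finset.expect_sub_distrib]
      refine Eq.trans (Finset.expect_congr rfl fun x _ => ?_) hodd
      have h2 : chi {i} x ^ 2 = 1 := by rw [pow_two]; exact chi_mul_self _ _
      have h3 : chi {i} x ^ 3 = chi {i} x := by rw [pow_succ, h2, one_mul]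
      have h4 : chi {i} x ^ 4 = 1 := by rw [show 4 = 2 * 2 from rfl, pow_mul, h2, one_pow]
      linear_combination 6 * g x ^ 2 * h x ^ 2 * h2 + 4 * g x * h x ^ 3 * h3 + h x ^ 4 * h4
    simp_rw [hf]
    rw [hexp, hN]
    have e1 := ih a
    have e2 := ih fun S => a (insert i S)
    have n1 : 0 ≤ ∑ S ∈ U.powerset, 3 ^ S.card * a S ^ 2 :=
      Finset.sum_nonneg fun S _ => by positivity
    have n2 : 0 ≤ ∑ S ∈ U.powerset, 3 ^ S.card * a (insert i S) ^ 2 :=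
      Finset.sum_nonneg fun S _ => by positivity
    have e3 := expect_mul_sq_le (fun x => g x ^ 2) (fun x => h x ^ 2)
    simp_rw [← pow_mul] at e3
    norm_num only at e3
    have n3 : 0 ≤ 𝔼 x : Cube n, h x ^ 4 := Finset.expect_nonneg fun x _ => by positivity
    have e4 : 𝔼 x : Cube n, g x ^ 2 * h x ^ 2 ≤
        (∑ S ∈ U.powerset, 3 ^ S.card * a S ^ 2) *
          ∑ S ∈ U.powerset, 3 ^ S.card * a (insert i S) ^ 2 := by
      refine (abs_le_of_sq_le_sq' ?_ (mul_nonneg n1 n2)).2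
      rw [mul_pow]
      exact e3.trans (mul_le_mul e1 e2 n3 (sq_nonneg _))
    nlinarith

theorem expect_pow_four_le {n : ℕ} (a : Finset (Fin n) → ℝ) :
    𝔼 x : Cube n, (∑ S, a S * chi S x) ^ 4 ≤ (∑ S, 3 ^ S.card * a S ^ 2) ^ 2 := by
  simpa using expect_pow_four_le_powerset Finset.univ a

/-- With `h` the degree-`d` truncation of `g`, the weight is `W = E[gh]`. Two Cauchy–Schwarz steps
give `W² ≤ ‖g‖₁ ‖g‖₂ ‖h‖₄²`, and `‖h‖₄² ≤ 3^d W`; divide by `W`. -/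
theorem low_degree_weight_le {n : ℕ} (g : Cube n → ℝ) (d : ℕ) :
    ∑ S : Finset (Fin n) with S.card ≤ d, cubeFourier g S ^ 2 ≤
      3 ^ d * ((𝔼 x, |g x|) * √(𝔼 x, g x ^ 2)) := by
  set a : Finset (Fin n) → ℝ := fun S => if S.card ≤ d then cubeFourier g S else 0 with ha
  set h : Cube n → ℝ := fun x => ∑ S, a S * chi S x with hh
  set W := ∑ S : Finset (Fin n) with S.card ≤ d, cubeFourier g S ^ 2 with hW
  have hWa : W = ∑ S, a S ^ 2 := by
    rw [hW, Finset.sum_filter]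
    refine Finset.sum_congr rfl fun S _ => ?_
    simp only [ha]
    split_ifs <;> simp
  have hW0 : 0 ≤ W := Finset.sum_nonneg fun _ _ => sq_nonneg _
  have hgh : W = 𝔼 x, g x * h x := by
    have := expect_sum_mul_sum_chi (cubeFourier g) a
    simp_rw [cubeFourier_inversion] at this
    rw [this, hW, Finset.sum_filter]
    refine Finset.sum_congr rfl fun S _ => ?_
    simp only [ha]
    split_ifs <;> ring
  have h4 : 𝔼 x, h x ^ 4 ≤ (3 ^ d * W) ^ 2 := by
    refine (expect_pow_four_le a).trans (pow_le_pow_left₀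
      (Finset.sum_nonneg fun S _ => by positivity) ?_ 2)
    rw [hWa, Finset.mul_sum]
    refine Finset.sum_le_sum fun S _ => ?_
    simp only [ha]
    split_ifs with hS
    · gcongr
      norm_num
    · simp
  have hA : 0 ≤ 𝔼 x, |g x| := Finset.expect_nonneg fun x _ => abs_nonneg _
  have s1 : W ^ 2 ≤ (𝔼 x, |g x|) * 𝔼 x, |g x| * h x ^ 2 := by
    have h1 := expect_mul_sq_le (fun x => √|g x|) (fun x => √|g x| * |h x|)
    have h2 : ∀ x, √|g x| * (√|g x| * |h x|) = |g x * h x| := fun x => by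
      rw [← mul_assoc, Real.mul_self_sqrt (abs_nonneg _), abs_mul]
    simp_rw [h2, mul_pow, Real.sq_sqrt (abs_nonneg _), sq_abs] at h1
    refine le_trans ?_ h1
    rw [hgh, sq_le_sq]
    refine (Finset.abs_expect_le _ _).trans (le_abs_self _)
  have s2 : 𝔼 x, |g x| * h x ^ 2 ≤ √(𝔼 x, g x ^ 2) * (3 ^ d * W) := by
    have h1 := expect_mul_sq_le (fun x => |g x|) (fun x => h x ^ 2)
    simp_rw [← pow_mul, sq_abs] at h1
    norm_num only at h1
    have hG : 0 ≤ 𝔼 x, g x ^ 2 := Finset.expect_nonneg fun x _ => sq_nonneg _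
    refine (abs_le_of_sq_le_sq' ?_ (by positivity)).2
    rw [mul_pow, Real.sq_sqrt hG]
    exact h1.trans (mul_le_mul_of_nonneg_left h4 hG)
  rcases hW0.eq_or_lt with h0 | h0
  · rw [← h0]; positivity
  · have s3 := s1.trans (mul_le_mul_of_nonneg_left s2 hA)
    refine le_of_mul_le_mul_right ?_ h0
    nlinarith

/-! ### Low-degree weight of small sets and of functions with small influences -/

/-- The Fourier weight at levels `1, …, d`. -/
noncomputable def weightMid {n : ℕ} (d : ℕ) (f : Cube n → ℝ) : ℝ :=
  ∑ S : Finset (Fin n) with 1 ≤ S.card ∧ S.card ≤ d, cubeFourier f S ^ 2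

theorem cubeFourier_empty {n : ℕ} (f : Cube n → ℝ) : cubeFourier f ∅ = 𝔼 x, f x := by
  simp [cubeFourier, chi_empty]

theorem cubeVar_eq {n : ℕ} (f : Cube n → Bool) :
    cubeVar (boolToReal f) =
      (𝔼 x, boolToReal f x) * (1 - 𝔼 x, boolToReal f x) := by
  unfold cubeVar
  set μ := 𝔼 x, boolToReal f x with hμ
  have : ∀ x, (boolToReal f x - μ) ^ 2 = (1 - 2 * μ) * boolToReal f x + μ ^ 2 := fun x => by
    linear_combination boolToReal_sq f x
  simp_rw [this]
  rw [Finset.expect_add_distrib, ← Finset.mul_expect, Fintype.expect_const, ← hμ]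
  ring

theorem cubeVar_nonneg {n : ℕ} (f : Cube n → ℝ) : 0 ≤ cubeVar f :=
  Finset.expect_nonneg fun _ _ => sq_nonneg _

theorem weightGe_one {n : ℕ} (f : Cube n → Bool) :
    weightGe 1 (boolToReal f) = cubeVar (boolToReal f) := by
  have hp := parseval (boolToReal f)
  rw [← Finset.add_sum_erase _ _ (Finset.mem_univ ∅), cubeFourier_empty] at hp
  simp_rw [boolToReal_sq] at hp
  have : weightGe 1 (boolToReal f) =
      ∑ S ∈ Finset.univ.erase ∅, cubeFourier (boolToReal f) S ^ 2 := by
    unfold weightGe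
    congr 1
    ext S
    simp [Finset.one_le_card, Finset.nonempty_iff_ne_empty]
  rw [this, cubeVar_eq]
  linarith

theorem weightMid_add_weightGe {n : ℕ} (f : Cube n → Bool) (d : ℕ) :
    weightMid d (boolToReal f) + weightGe (d + 1) (boolToReal f) = cubeVar (boolToReal f) := by
  rw [← weightGe_one]
  unfold weightMid weightGe
  rw [← Finset.sum_union]
  · congr 1
    ext S
    simp only [Finset.mem_union, Finset.mem_filter, Finset.mem_univ, true_and]
    omega
  · rw [Finset.disjoint_filter]
    intro S _
    omega

/-- Centering `f` changes only the empty coefficient, and the centered function has `L¹` norm `2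
var` and `L²` norm `√var`. -/
theorem weightMid_le_of_cubeVar {n : ℕ} (f : Cube n → Bool) (d : ℕ) :
    weightMid d (boolToReal f) ≤
      2 * 3 ^ d * (cubeVar (boolToReal f) * √(cubeVar (boolToReal f))) := by
  set V := cubeVar (boolToReal f) with hV
  set μ := 𝔼 x, boolToReal f x with hμ
  set g : Cube n → ℝ := fun x => boolToReal f x - μ with hg
  have hμ0 : 0 ≤ μ := Finset.expect_nonneg fun x _ => boolToReal_nonneg f x
  have hμ1 : μ ≤ 1 := Finset.expect_le Finset.univ_nonempty fun x _ => boolToReal_le_one f x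
  have h2 : 𝔼 x, g x ^ 2 = V := rfl
  have h1 : 𝔼 x, |g x| = 2 * V := by
    have : ∀ x, |g x| = (1 - 2 * μ) * boolToReal f x + μ := fun x => by
      simp only [hg, boolToReal]
      split_ifs
      · rw [abs_of_nonneg (by linarith)]; ring
      · rw [abs_of_nonpos (by linarith)]; ring
    simp_rw [this]
    rw [Finset.expect_add_distrib, ← Finset.mul_expect, Fintype.expect_const, ← hμ, hV, cubeVar_eq]
    ring
  have h3 := low_degree_weight_le g d
  rw [h1, h2] at h3
  have h4 : weightMid d (boolToReal f) ≤
      ∑ S : Finset (Fin n) with S.card ≤ d, cubeFourier g S ^ 2 := by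
    unfold weightMid
    have : ∀ S : Finset (Fin n), 1 ≤ S.card → cubeFourier g S = cubeFourier (boolToReal f) S := by
      intro S hS
      have hne : S ≠ ∅ := Finset.nonempty_iff_ne_empty.1 (Finset.one_le_card.1 hS)
      have h0 := expect_chi_mul_chi S ∅
      simp only [chi_empty, mul_one, hne, if_false] at h0
      simp only [cubeFourier, hg, sub_mul]
      rw [Finset.expect_sub_distrib, ← Finset.mul_expect, h0]
      ring
    rw [Finset.sum_congr rfl fun S hS => by rw [← this S (Finset.mem_filter.1 hS).2.1]]
    refine Finset.sum_le_sum_of_subset_of_nonneg ?_ fun _ _ _ => sq_nonneg _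
    intro S
    simp only [Finset.mem_filter]
    tauto
  linarith

/-- The noise operator `T_ρ`. -/
noncomputable def noiseOp {n : ℕ} (ρ : ℝ) (g : Cube n → ℝ) (x : Cube n) : ℝ :=
  𝔼 y : Cube n, g y * ∏ i, (1 + ρ * (chi {i} x * chi {i} y))

theorem noiseOp_eq_sum {n : ℕ} (ρ : ℝ) (g : Cube n → ℝ) (x : Cube n) :
    noiseOp ρ g x = ∑ S, (ρ ^ S.card * cubeFourier g S) * chi S x := by
  unfold noiseOp cubeFourier
  simp_rw [← sum_pow_mul_chi_mul_chi, Finset.mul_sum]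
  rw [Finset.expect_sum_comm]
  refine Finset.sum_congr rfl fun S _ => ?_
  rw [Finset.mul_expect, Finset.expect_mul]
  exact Finset.expect_congr rfl fun y _ => by ring

/-- The kernel is nonnegative and has mean 1 in `x`. -/
theorem expect_abs_noiseOp_le {n : ℕ} {ρ : ℝ} (h0 : 0 ≤ ρ) (h1 : ρ ≤ 1) (g : Cube n → ℝ) :
    𝔼 x, |noiseOp ρ g x| ≤ 𝔼 x, |g x| := by
  have hpos : ∀ x y : Cube n, 0 ≤ ∏ i, (1 + ρ * (chi {i} x * chi {i} y)) := fun x y =>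
    Finset.prod_nonneg fun i _ => by
      have := abs_chi {i} x
      have h' := abs_chi {i} y
      have h2 : |chi {i} x * chi {i} y| = 1 := by rw [abs_mul, this, h', one_mul]
      have h3 := neg_abs_le (chi {i} x * chi {i} y)
      nlinarith
  have hone : ∀ y : Cube n, 𝔼 x : Cube n, ∏ i, (1 + ρ * (chi {i} x * chi {i} y)) = 1 := by
    intro y
    have hsum := noiseOp_eq_sum ρ (fun _ => 1) y
    have hF : ∀ S : Finset (Fin n), cubeFourier (fun _ => (1 : ℝ)) S = if ∅ = S then 1 else 0 := by
      intro S
      rw [← expect_chi_mul_chi]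
      simp [cubeFourier, chi_empty]
    simp only [noiseOp, one_mul, hF] at hsum
    simpa [chi_empty, mul_comm] using hsum
  calc 𝔼 x, |noiseOp ρ g x|
      ≤ 𝔼 x : Cube n, 𝔼 y : Cube n, |g y| * ∏ i, (1 + ρ * (chi {i} x * chi {i} y)) := by
        refine Finset.expect_le_expect fun x _ => ?_
        refine (Finset.abs_expect_le _ _).trans_eq (Finset.expect_congr rfl fun y _ => ?_)
        rw [abs_mul, abs_of_nonneg (hpos x y)]
    _ = 𝔼 y : Cube n, |g y| * 𝔼 x : Cube n, ∏ i, (1 + ρ * (chi {i} x * chi {i} y)) := by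
        rw [Finset.expect_comm]
        simp_rw [Finset.mul_expect]
    _ = _ := by simp_rw [hone, mul_one]

/-- The discrete derivative in direction `i`, keeping the factor `χ_i`. -/
noncomputable def cubeLap {n : ℕ} (i : Fin n) (g : Cube n → ℝ) (x : Cube n) : ℝ :=
  (g x - g (flipAt x i)) / 2

theorem cubeFourier_cubeLap {n : ℕ} (i : Fin n) (g : Cube n → ℝ) (S : Finset (Fin n)) :
    cubeFourier (cubeLap i g) S = if i ∈ S then cubeFourier g S else 0 := by
  have h := expect_flipAt (fun x => g (flipAt x i) * chi S x) i
  simp only [flipAt_flipAt] at h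
  have h2 : cubeFourier (cubeLap i g) S =
      (cubeFourier g S - 𝔼 x, g (flipAt x i) * chi S x) / 2 := by
    unfold cubeFourier cubeLap
    rw [← Finset.expect_sub_distrib, Finset.expect_div]
    exact Finset.expect_congr rfl fun x _ => by ring
  rw [h2, ← h]
  split_ifs with hi
  · simp_rw [chi_flipAt_of_mem hi, mul_neg, Finset.expect_neg_distrib]
    unfold cubeFourier; ring
  · simp_rw [chi_flipAt_of_notMem hi]
    unfold cubeFourier; ring

theorem expect_abs_cubeLap {n : ℕ} (i : Fin n) (f : Cube n → Bool) :
    𝔼 x, |cubeLap i (boolToReal f) x| = influence f i / 2 := by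
  unfold influence
  rw [Finset.expect_div]
  refine Finset.expect_congr rfl fun x _ => ?_
  unfold cubeLap boolToReal
  cases f x <;> cases f (flipAt x i) <;> norm_num

/-- Apply the low-degree bound to the smoothed derivatives `G i` and sum by Cauchy–Schwarz.
Smoothing keeps `∑ ‖G i‖₂²` below 1, since `|S| ≤ 4^|S|`, whereas without it this sum is of the
order of the total influence. It costs `4^d` at levels up to `d`, whence `12 = 4 · 3`. -/
theorem weightMid_le_of_influence {n : ℕ} (f : Cube n → Bool) (d : ℕ) :
    weightMid d (boolToReal f) ≤ 12 ^ d * √(∑ i, influence f i ^ 2) := by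
  set F := boolToReal f with hF
  set G : Fin n → Cube n → ℝ := fun i => noiseOp (1 / 2) (cubeLap i F) with hG
  have hfun : ∀ i, G i = fun x => ∑ S,
      ((1 / 2) ^ S.card * cubeFourier (cubeLap i F) S) * chi S x := fun i =>
    funext fun x => noiseOp_eq_sum _ _ _
  have hfour : ∀ i S, cubeFourier (G i) S ^ 2 =
      if i ∈ S then (1 / 4) ^ S.card * cubeFourier F S ^ 2 else 0 := fun i S => by
    rw [hfun, cubeFourier_sum_chi, cubeFourier_cubeLap]
    split_ifs
    · rw [mul_pow, ← pow_mul, mul_comm S.card, pow_mul]; norm_num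
    · simp
  have hinf0 : ∀ i, 0 ≤ influence f i := fun i =>
    Finset.expect_nonneg fun x _ => by split_ifs <;> norm_num
  have hL1 : ∀ i, 𝔼 x, |G i x| ≤ influence f i := fun i => by
    have := expect_abs_noiseOp_le (ρ := 1 / 2) (by norm_num) (by norm_num) (cubeLap i F)
    rw [expect_abs_cubeLap] at this
    exact this.trans (by linarith [hinf0 i])
  have hL2 : ∑ i, 𝔼 x, G i x ^ 2 ≤ 1 := by
    simp_rw [← parseval, hfour]
    rw [Finset.sum_comm]
    refine le_trans (Finset.sum_le_sum fun S _ => ?_) (sum_cubeFourier_sq_le_one f)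
    simp only [Finset.sum_ite_mem, Finset.univ_inter, Finset.sum_const, nsmul_eq_mul]
    have h1 : (S.card : ℝ) ≤ 4 ^ S.card := by
      exact_mod_cast (Nat.lt_pow_self (by norm_num : 1 < 4)).le
    have h2 : (S.card : ℝ) * (1 / 4) ^ S.card ≤ 1 := by
      rw [one_div, inv_pow, ← div_eq_mul_inv, div_le_one (by positivity)]
      exact h1
    have h3 := sq_nonneg (cubeFourier F S)
    nlinarith
  have hlow : (1 / 4 : ℝ) ^ d * weightMid d F ≤
      ∑ i, ∑ S : Finset (Fin n) with S.card ≤ d, cubeFourier (G i) S ^ 2 := by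
    simp_rw [hfour]
    rw [Finset.sum_comm, weightMid, Finset.mul_sum]
    have hnn : ∀ S : Finset (Fin n),
        0 ≤ ∑ i, if i ∈ S then (1 / 4 : ℝ) ^ S.card * cubeFourier F S ^ 2 else 0 := fun S =>
      Finset.sum_nonneg fun i _ => by split_ifs <;> positivity
    refine le_trans (Finset.sum_le_sum (g := fun S =>
      ∑ i, if i ∈ S then (1 / 4 : ℝ) ^ S.card * cubeFourier F S ^ 2 else 0) fun S hS => ?_)
      (Finset.sum_le_sum_of_subset_of_nonneg ?_ fun S _ _ => hnn S)
    · obtain ⟨h1, h2⟩ := (Finset.mem_filter.1 hS).2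
      simp only [Finset.sum_ite_mem, Finset.univ_inter, Finset.sum_const, nsmul_eq_mul]
      have h3 : (1 / 4 : ℝ) ^ d ≤ (1 / 4) ^ S.card :=
        pow_le_pow_of_le_one (by norm_num) (by norm_num) h2
      have h4 : (1 : ℝ) ≤ S.card := by exact_mod_cast h1
      have h5 : (1 / 4 : ℝ) ^ d * cubeFourier F S ^ 2 ≤ (1 / 4) ^ S.card * cubeFourier F S ^ 2 :=
        mul_le_mul_of_nonneg_right h3 (sq_nonneg _)
      have h6 : 0 ≤ (1 / 4 : ℝ) ^ S.card * cubeFourier F S ^ 2 := by positivity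
      nlinarith
    · intro S
      simp only [Finset.mem_filter]
      tauto
  have hup : ∑ i, ∑ S : Finset (Fin n) with S.card ≤ d, cubeFourier (G i) S ^ 2 ≤
      3 ^ d * √(∑ i, influence f i ^ 2) := by
    calc _ ≤ ∑ i, 3 ^ d * (influence f i * √(𝔼 x, G i x ^ 2)) :=
          Finset.sum_le_sum fun i _ => (low_degree_weight_le (G i) d).trans (by
            gcongr
            exact hL1 i)
      _ = 3 ^ d * ∑ i, influence f i * √(𝔼 x, G i x ^ 2) := by rw [Finset.mul_sum]
      _ ≤ 3 ^ d * (√(∑ i, influence f i ^ 2) * 1) := by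
          refine mul_le_mul_of_nonneg_left ((Real.sum_mul_le_sqrt_mul_sqrt _ _ _).trans
            (mul_le_mul_of_nonneg_left ?_ (Real.sqrt_nonneg _))) (by positivity)
          rw [Real.sqrt_le_one]
          refine le_trans (le_of_eq (Finset.sum_congr rfl fun i _ => ?_)) hL2
          exact Real.sq_sqrt (Finset.expect_nonneg fun x _ => sq_nonneg _)
      _ = _ := by rw [mul_one]
  have := hlow.trans hup
  calc weightMid d F = 4 ^ d * ((1 / 4) ^ d * weightMid d F) := by
        rw [← mul_assoc, ← mul_pow]; norm_num
    _ ≤ 4 ^ d * (3 ^ d * √(∑ i, influence f i ^ 2)) := by gcongr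
    _ = _ := by rw [← mul_assoc, ← mul_pow]; norm_num

/-! ### The isoperimetric inequalities -/

theorem cubeVar_le_talagrandCol {n : ℕ} (f : Cube n → Bool) (col : EdgeColoring n) :
    cubeVar (boolToReal f) ≤ 16 * talagrandCol col f := by
  simpa [weightGe_one] using sqrt_mul_weightGe_le f col 1

/-- Common to items 3 and 4; the form of the hypothesis accommodates both low-level bounds. It puts
half of the variance above a level proportional to `L`. -/
theorem cubeVar_mul_sqrt_le_of_weightMid_le {n : ℕ} (f : Cube n → Bool) (col : EdgeColoring n)
    (L : ℝ) (h : ∀ d : ℕ, weightMid d (boolToReal f) ≤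
      2 * 12 ^ d * (cubeVar (boolToReal f) * Real.exp (-L))) :
    cubeVar (boolToReal f) * √L ≤ 96 * talagrandCol col f := by
  have hV := cubeVar_le_talagrandCol f col
  have hT := talagrandCol_nonneg col f
  have hV0 := cubeVar_nonneg (boolToReal f)
  rcases lt_or_ge L 3 with hL | hL
  · have : √L ≤ 2 := by
      rw [Real.sqrt_le_left (by norm_num)]
      linarith
    nlinarith
  -- As `12 ≤ e³`, this gives `12^d ≤ e^(L/2)`, so the factor `e^(-L)` still leaves `e^(-L/2) ≤
  -- 1/4`; and `L < 6(d+1)` keeps `√L` comparable to `√(d+1)`.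
  · set d := ⌊L / 6⌋₊ with hd
    have hd1 : (d : ℝ) ≤ L / 6 := Nat.floor_le (by linarith)
    have hd2 : L / 6 < d + 1 := Nat.lt_floor_add_one _
    have he3 : (12 : ℝ) ≤ Real.exp 3 := by
      have h1 := Real.exp_one_gt_d9
      have : Real.exp 3 = Real.exp 1 ^ 3 := by rw [← Real.exp_nat_mul]; norm_num
      rw [this]
      calc (12 : ℝ) ≤ 2.7 ^ 3 := by norm_num
        _ ≤ _ := by gcongr; linarith
    have h12 : (12 : ℝ) ^ d ≤ Real.exp (L / 2) := by
      calc (12 : ℝ) ^ d ≤ Real.exp 3 ^ d := by gcongr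
        _ = Real.exp (d * 3) := by rw [Real.exp_nat_mul]
        _ ≤ _ := Real.exp_le_exp.2 (by linarith)
    have h4 : (4 : ℝ) ≤ Real.exp (L / 2) := by
      have h1 := Real.exp_one_gt_d9
      have h2 := Real.add_one_le_exp (1 / 2 : ℝ)
      calc (4 : ℝ) ≤ Real.exp 1 * Real.exp (1 / 2) := by nlinarith
        _ = Real.exp (1 + 1 / 2) := by rw [Real.exp_add]
        _ ≤ _ := Real.exp_le_exp.2 (by linarith)
    have hsmall : (12 : ℝ) ^ d * Real.exp (-L) ≤ 1 / 4 := by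
      have hpos := Real.exp_pos (L / 2)
      have hexp : Real.exp (-L) = (Real.exp (L / 2))⁻¹ * (Real.exp (L / 2))⁻¹ := by
        rw [← Real.exp_neg, ← Real.exp_add]; congr 1; ring
      calc (12 : ℝ) ^ d * Real.exp (-L) ≤ Real.exp (L / 2) * Real.exp (-L) := by gcongr
        _ = (Real.exp (L / 2))⁻¹ := by rw [hexp]; field_simp
        _ ≤ 4⁻¹ := inv_anti₀ (by norm_num) h4
        _ = 1 / 4 := by norm_num
    have hmid : weightMid d (boolToReal f) ≤ cubeVar (boolToReal f) / 2 := by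
      refine (h d).trans ?_
      nlinarith [mul_le_mul_of_nonneg_left hsmall hV0]
    have hsum := weightMid_add_weightGe f d
    have hW := sqrt_mul_weightGe_le f col (d + 1)
    push_cast at hW
    have hs : √L ≤ 3 * √((d : ℝ) + 1) := by
      rw [show (3 : ℝ) = √(3 ^ 2) by rw [Real.sqrt_sq (by norm_num)],
        ← Real.sqrt_mul (by norm_num)]
      exact Real.sqrt_le_sqrt (by linarith)
    have hs0 := Real.sqrt_nonneg ((d : ℝ) + 1)
    calc cubeVar (boolToReal f) * √L
        ≤ cubeVar (boolToReal f) * (3 * √((d : ℝ) + 1)) := by gcongr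
      _ ≤ (2 * weightGe (d + 1) (boolToReal f)) * (3 * √((d : ℝ) + 1)) := by
          gcongr
          linarith
      _ ≤ _ := by linarith

theorem cubeVar_mul_sqrt_log_le {n : ℕ} (f : Cube n → Bool) (col : EdgeColoring n) :
    cubeVar (boolToReal f) * √(Real.log (1 / cubeVar (boolToReal f))) ≤
      192 * talagrandCol col f := by
  have hT := talagrandCol_nonneg col f
  rcases (cubeVar_nonneg (boolToReal f)).eq_or_lt with h0 | h0
  · rw [← h0, zero_mul]; linarith
  set V := cubeVar (boolToReal f) with hV
  have key := cubeVar_mul_sqrt_le_of_weightMid_le f col (Real.log (1 / V) / 2) ?_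
  · have : √(Real.log (1 / V)) ≤ 2 * √(Real.log (1 / V) / 2) := by
      rcases le_or_gt (Real.log (1 / V)) 0 with hl | hl
      · rw [Real.sqrt_eq_zero_of_nonpos hl]; positivity
      · rw [Real.sqrt_le_left (by positivity), mul_pow, Real.sq_sqrt (by linarith)]
        linarith
    nlinarith [mul_le_mul_of_nonneg_left this h0.le]
  · intro d
    have hexp : Real.exp (-(Real.log (1 / V) / 2)) = √V := by
      rw [one_div, Real.log_inv, Real.sqrt_eq_rpow, Real.rpow_def_of_pos h0]
      congr 1; ring
    rw [hexp]
    refine (weightMid_le_of_cubeVar f d).trans ?_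
    gcongr
    norm_num

theorem cubeVar_mul_sqrt_log_influence_le {n : ℕ} (f : Cube n → Bool) (col : EdgeColoring n) :
    cubeVar (boolToReal f) * √(Real.log (1 + 1 / ∑ i : Fin n, influence f i ^ 2)) ≤
      400 * talagrandCol col f := by
  have hT := talagrandCol_nonneg col f
  have hV0 := cubeVar_nonneg (boolToReal f)
  have hVT := cubeVar_le_talagrandCol f col
  have hlog2 : Real.log 2 ≤ 1 := by linarith [Real.log_two_lt_d9]
  have hmid := weightMid_le_of_influence f
  have h3 := cubeVar_mul_sqrt_log_le f col
  have hM0 : 0 ≤ ∑ i : Fin n, influence f i ^ 2 := Finset.sum_nonneg fun i _ => sq_nonneg _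
  set M := ∑ i : Fin n, influence f i ^ 2 with hM
  set V := cubeVar (boolToReal f) with hV
  -- For `M = 0` the convention `1 / 0 = 0` makes the logarithm vanish.
  rcases hM0.eq_or_lt with h0 | h0
  · rw [← h0]; simp; linarith
  rcases le_or_gt 1 M with h1 | h1
  · have : √(Real.log (1 + 1 / M)) ≤ 1 := by
      rw [Real.sqrt_le_one]
      refine le_trans (Real.log_le_log (by positivity) ?_) hlog2
      have : 1 / M ≤ 1 := by rw [div_le_one h0]; exact h1
      linarith
    nlinarith
  set l := -Real.log M with hl
  have hl0 : 0 < l := by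
    have := Real.log_neg h0 h1
    linarith
  have hsplit : √(Real.log (1 + 1 / M)) ≤ 1 + √l := by
    rw [Real.sqrt_le_left (by positivity)]
    have h4 : Real.log (1 + 1 / M) ≤ Real.log (2 / M) := by
      refine Real.log_le_log (by positivity) ?_
      rw [le_div_iff₀ h0, add_mul, one_div, inv_mul_cancel₀ h0.ne']
      linarith
    rw [Real.log_div (by norm_num) h0.ne'] at h4
    nlinarith [Real.sq_sqrt hl0.le, Real.sqrt_nonneg l]
  have hsq : √l = 2 * √(l / 4) := by
    rw [show l / 4 = l / 2 ^ 2 by norm_num, Real.sqrt_div hl0.le, Real.sqrt_sq (by norm_num)]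
    ring
  have hkey : V * √(l / 4) ≤ 192 * talagrandCol col f := by
    -- The threshold is `M^(1/4)`. If `V` is at least this, then `√M ≤ V M^(1/4)` and the influence
    -- bound has the required form; otherwise `log(1/V) > l/4` and item 3 suffices.
    rcases le_or_gt (Real.exp (-(l / 4))) V with hc | hc
    · refine (cubeVar_mul_sqrt_le_of_weightMid_le f col (l / 4) fun d => ?_).trans (by linarith)
      have hsM : √M = Real.exp (-(l / 4)) * Real.exp (-(l / 4)) := by
        rw [Real.sqrt_eq_rpow, Real.rpow_def_of_pos h0, ← Real.exp_add]
        congr 1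
        rw [hl]; ring
      have hpos := Real.exp_pos (-(l / 4))
      calc weightMid d (boolToReal f) ≤ 12 ^ d * √M := hmid d
        _ ≤ 12 ^ d * (V * Real.exp (-(l / 4))) := by rw [hsM]; gcongr
        _ ≤ 2 * 12 ^ d * (V * Real.exp (-(l / 4))) := by
            have : 0 ≤ 12 ^ d * (V * Real.exp (-(l / 4))) := by positivity
            linarith
    · rcases hV0.eq_or_lt with hv | hv
      · rw [← hv, zero_mul]; linarith
      · refine le_trans (mul_le_mul_of_nonneg_left (Real.sqrt_le_sqrt ?_) hv.le) h3
        rw [one_div, Real.log_inv]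
        have := Real.log_lt_log hv hc
        rw [Real.log_exp] at this
        linarith
  calc V * √(Real.log (1 + 1 / M)) ≤ V * (1 + √l) := by gcongr
    -- The constant is `16 + 2 · 192 = 400`.
    _ ≤ _ := by rw [hsq]; linarith

theorem mainTheorem7 :
    (∀ (n : ℕ) (f : Cube n → Bool) (col : EdgeColoring n),
      talagrandCol col f ≥ 1 / 2 * Real.sqrt (weightEq 1 (boolToReal f))) ∧
    (∃ c : ℝ, 0 < c ∧ ∀ (n d : ℕ) (f : Cube n → Bool) (col : EdgeColoring n),
      talagrandCol col f ≥ c * (Real.sqrt (d : ℝ) * weightGe d (boolToReal f))) ∧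
    (∃ c : ℝ, 0 < c ∧ ∀ (n : ℕ) (f : Cube n → Bool) (col : EdgeColoring n),
      talagrandCol col f ≥
        c * cubeVar (boolToReal f) * Real.sqrt (Real.log (1 / cubeVar (boolToReal f)))) ∧
    (∃ c : ℝ, 0 < c ∧ ∀ (n : ℕ) (f : Cube n → Bool) (col : EdgeColoring n),
      talagrandCol col f ≥
        c * cubeVar (boolToReal f) *
          Real.sqrt (Real.log (1 + 1 / ∑ i : Fin n, influence f i ^ 2))) := by
  refine ⟨fun n f col => ?_, ⟨1 / 16, by norm_num, fun n d f col => ?_⟩,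
    ⟨1 / 192, by norm_num, fun n f col => ?_⟩, ⟨1 / 400, by norm_num, fun n f col => ?_⟩⟩
  · have h := sqrt_weightEq_one_le_talagrandCol f col
    linarith [Real.sqrt_nonneg (weightEq 1 (boolToReal f))]
  · linarith [sqrt_mul_weightGe_le f col d]
  · linarith [cubeVar_mul_sqrt_log_le f col]
  · linarith [cubeVar_mul_sqrt_log_influence_le f col]
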